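/- Let $n\ge 3$ be an integer, let $\mathbb B^n$ be the open unit ball of $\mathbb R^n$ with the Euclidean norm $|\cdot|$, and let $\sigma$ be the surface measure on $\mathbb S^{n-1}$ normalized by $\sigma(\mathbb S^{n-1})=1$. Let $\alpha,\beta\in\mathbb R$ with $n+\alpha=\beta+1$ and $\beta\ge n$, and put $$P_{\alpha,\beta}(x,\eta)=\frac{(1-|x|^2)^{\alpha}}{|x-\eta|^{\beta}}\quad(x\in\mathbb B^n,\ \eta\in\mathbb S^{n-1}),\qquad c_{n,\beta}=\frac{\Gamma(\frac{\beta}{2})\,\Gamma(\frac{\beta}{2}-\frac n2+1)}{\Gamma(\frac n2)\,\Gamma(\beta-n+1)},$$ $$u_{\alpha,\beta}[\varphi](x)=c_{n,\beta}\int_{\mathbb S^{n-1}}P_{\alpha,\beta}(x,\eta)\,\varphi(\eta)\,d\sigma(\eta).$$ Let $1<p\le\infty$ and let $q\in[1,\infty)$ be its conjugate exponent, $\frac1p+\frac1q=1$ (with $\frac1p=\frac qp=0$ if $p=\infty$). For $x\in\mathbb B^n$ set $$C_p(x)=c_{n,\beta}\,\Big(F\big(\tfrac{n-q\beta}{2},\,n-1-\tfrac{q\beta}{2};\,\tfrac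 n2;\,|x|^2\big)\Big)^{1/q},$$ where $F(a,b;c;t)=\sum_{k\ge0}\frac{(a)_k(b)_k}{(c)_k}\frac{t^k}{k!}$, $|t|<1$, is the Gauss hypergeometric function. Then for every $x\in\mathbb B^n$: 1. For every $\varphi\in L^p(\mathbb S^{n-1},\mathbb R^n)$ (with respect to $\sigma$), the integral defining $u_{\alpha,\beta}[\varphi](x)$ converges absolutely and $$|u_{\alpha,\beta}[\varphi](x)|\le\frac{C_p(x)}{(1-|x|^2)^{(n-1)/p}}\,\|\varphi\|_{L^p}.$$ 2. For every unit vector $e\in\mathbb R^n$, the function $\varphi_0(\eta)=P_{\alpha,\beta}(x,\eta)^{q/p}\,e$ belongs to $L^p(\mathbb S^{n-1},\mathbb R^n)$, has $\|\varphi_0\|_{L^p}>0$, and gives equality in this inequality at $x$. 3. The inequality is sharp at each $x$: $C_p(x)$ is the smallest real number $C$ such that $|u_{\alpha,\beta}[\varphi](x)|\le C\,(1-|x|^2)^{-(n-1)/p}\,\|\varphi\|_{L^p}$ for all $\varphi\in L^p(\mathbb S^{n-1},\mathbb R^n)$. -/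

import Mathlib

open MeasureTheory Metric

noncomputable section

/-- The surface measure `σ` of the unit sphere of `ℝⁿ`, normalized to total mass one. -/
def normSurfaceMeasure (n : ℕ) : Measure (sphere (0 : EuclideanSpace ℝ (Fin n)) 1) :=
  ((volume : Measure (EuclideanSpace ℝ (Fin n))).toSphere Set.univ)⁻¹ •
    (volume : Measure (EuclideanSpace ℝ (Fin n))).toSphere

/-- The general Poisson kernel `P_{α,β}(x,η) = (1 - |x|²)^α / |x - η|^β`. -/
def poissonKer {n : ℕ} (α β : ℝ) (x : EuclideanSpace ℝ (Fin n))
    (η : sphere (0 : EuclideanSpace ℝ (Fin n)) 1) : ℝ :=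
  (1 - ‖x‖ ^ 2) ^ α / ‖x - (η : EuclideanSpace ℝ (Fin n))‖ ^ β

/-- The normalizing constant `c_{n,β}`. -/
def poissonConst (n : ℕ) (β : ℝ) : ℝ :=
  (Real.Gamma (β / 2) * Real.Gamma (β / 2 - n / 2 + 1)) /
    (Real.Gamma (n / 2) * Real.Gamma (β - n + 1))

/-- The general Poisson integral
`u_{α,β}[φ](x) = c_{n,β} ∫ P_{α,β}(x,η) φ(η) dσ(η)`. -/
def poissonInt {n : ℕ} (α β : ℝ)
    (φ : sphere (0 : EuclideanSpace ℝ (Fin n)) 1 → EuclideanSpace ℝ (Fin n))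
    (x : EuclideanSpace ℝ (Fin n)) : EuclideanSpace ℝ (Fin n) :=
  poissonConst n β • ∫ η, poissonKer α β x η • φ η ∂(normSurfaceMeasure n)

/-- The function `C_p(x) = c_{n,β} F((n-qβ)/2, n-1-qβ/2; n/2; |x|²)^{1/q}`, in terms of the
(finite) conjugate exponent `q` of `p`. -/
def sharpFun {n : ℕ} (β q : ℝ) (x : EuclideanSpace ℝ (Fin n)) : ℝ :=
  poissonConst n β *
    (₂F₁ ((n - q * β) / 2) (n - 1 - q * β / 2) ((n : ℝ) / 2) (‖x‖ ^ 2)) ^ (1 / q)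

end

/-! For fixed x in the ball the kernel P is continuous and positive in η, so Hölder bounds |u(x)| by
c‖P‖_q‖φ‖_p, and P^{q/p} e is the equality case because 1 + q/p = q. What remains is ‖P‖_q, that is,
the spherical mean of |x - η|^{-m} at m = qβ (`integral_norm_sub_rpow`).

The mean is identified through an ODE in r = |x|. By rotation invariance it equals u(r) = ∫ (1 + r²
- 2rs)^{-m/2} dσ, with s a coordinate of η. Differentiation under the integral and integration by
parts on the sphere (`integral_zonal_by_parts`) give a second-order equation, singular at r = 0. The
candidate v(r) = (1 - r²)^{n-1-m} F(r²) solves the same equation because F solves the hypergeometric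
one. Both are 1 at r = 0, and a weighted Wronskian that is constant and vanishes at the singular
point forces u = v (`eq_of_singular_ode`). -/

/-! ### Power series and the hypergeometric equation -/

/-- For ρ < R < 1 the terms |c k| R^k are bounded, so the differentiated series is dominated by a
multiple of ∑ (k + 1)(ρ/R)^k. -/
theorem summable_powerSeries_deriv {c : ℕ → ℝ}
    (hc : ∀ ρ : ℝ, 0 ≤ ρ → ρ < 1 → Summable fun k => |c k| * ρ ^ k) {ρ : ℝ} (h0 : 0 ≤ ρ)
    (h1 : ρ < 1) : Summable fun k : ℕ => |((k : ℝ) + 1) * c (k + 1)| * ρ ^ k := by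
  obtain ⟨R, hρR, hR1⟩ := exists_between h1
  have hR0 : 0 < R := h0.trans_lt hρR
  have hs := hc R hR0.le hR1
  set M := ∑' k, |c k| * R ^ k
  have hM : ∀ k, |c k| * R ^ k ≤ M := fun k =>
    hs.le_tsum k fun j _ => by positivity
  have hq0 : 0 ≤ ρ / R := by positivity
  have hq : ‖ρ / R‖ < 1 := by
    rw [Real.norm_of_nonneg hq0, div_lt_one hR0]; exact hρR
  have hg : Summable fun k : ℕ => ((k : ℝ) ^ 1 * (ρ / R) ^ k + (ρ / R) ^ k) * (M / R) :=
    ((summable_pow_mul_geometric_of_norm_lt_one 1 hq).add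
      (summable_geometric_of_norm_lt_one hq)).mul_right _
  refine Summable.of_nonneg_of_le (fun k => by positivity) (fun k => ?_) hg
  have h2 : |c (k + 1)| ≤ M / R ^ (k + 1) := by
    rw [le_div_iff₀ (by positivity)]; exact hM _
  calc |((k : ℝ) + 1) * c (k + 1)| * ρ ^ k = ((k : ℝ) + 1) * |c (k + 1)| * ρ ^ k := by
        rw [abs_mul, abs_of_nonneg (by positivity : (0 : ℝ) ≤ (k : ℝ) + 1)]
    _ ≤ ((k : ℝ) + 1) * (M / R ^ (k + 1)) * ρ ^ k := by gcongr
    _ = _ := by rw [div_pow]; field_simp; ring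

theorem hasSum_powerSeries {c : ℕ → ℝ}
    (hc : ∀ ρ : ℝ, 0 ≤ ρ → ρ < 1 → Summable fun k => |c k| * ρ ^ k) {t : ℝ} (ht : |t| < 1) :
    HasSum (fun k => c k * t ^ k) (∑' k, c k * t ^ k) := by
  refine Summable.hasSum (Summable.of_norm ?_)
  simpa [abs_mul] using hc |t| (abs_nonneg t) ht

theorem hasDerivAt_powerSeries {c : ℕ → ℝ}
    (hc : ∀ ρ : ℝ, 0 ≤ ρ → ρ < 1 → Summable fun k => |c k| * ρ ^ k) {t : ℝ} (ht : |t| < 1) :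
    HasDerivAt (fun t => ∑' k, c k * t ^ k) (∑' k : ℕ, ((k : ℝ) + 1) * c (k + 1) * t ^ k) t := by
  obtain ⟨R, hR, hR1⟩ := exists_between ht
  have hR0 : 0 ≤ R := (abs_nonneg t).trans hR.le
  have hd := summable_powerSeries_deriv hc hR0 hR1
  have hu : Summable fun k : ℕ => |(k : ℝ) * c k| * R ^ (k - 1) := by
    rw [← summable_nat_add_iff 1]; simpa using hd
  have key := hasDerivAt_tsum_of_isPreconnected (t := ball (0 : ℝ) R) (y := t) (y₀ := 0)
    (g := fun k t => c k * t ^ k) (g' := fun k t => c k * (k * t ^ (k - 1))) hu isOpen_ball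
    (convex_ball _ _).isPreconnected (fun k y _ => (hasDerivAt_pow k y).const_mul _)
    (fun k y hy => ?_) (by simpa using (abs_nonneg t).trans_lt hR)
    (by simpa using (hasSum_powerSeries hc (t := 0) (by simp)).summable) (by simpa using hR)
  · convert! key using 1
    have hs : Summable fun k : ℕ => c k * (k * t ^ (k - 1)) := by
      rw [← summable_nat_add_iff 1]
      refine ((hasSum_powerSeries (c := fun k => ((k : ℝ) + 1) * c (k + 1))
        (fun ρ h0 h1 => summable_powerSeries_deriv hc h0 h1) ht).summable).congr fun k => ?_
      simp; ring
    rw [hs.tsum_eq_zero_add]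
    simp only [Nat.cast_zero, zero_mul, mul_zero, zero_add]
    refine tsum_congr fun k => ?_
    simp; ring
  · have hy' : |y| ≤ R := by simpa using (mem_ball_zero_iff.1 hy).le
    rw [Real.norm_eq_abs, show c k * (k * y ^ (k - 1)) = (k * c k) * y ^ (k - 1) by ring, abs_mul,
      abs_pow]
    gcongr

/-- This recurrence is the differential equation read coefficientwise; it also drives the ratio test
below. -/
theorem ordinaryHypergeometricCoefficient_succ (a b : ℝ) {c : ℝ} (hc : 0 < c) (k : ℕ) :
    ((k : ℝ) + 1) * (c + k) * ordinaryHypergeometricCoefficient a b c (k + 1) =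
      (a + k) * (b + k) * ordinaryHypergeometricCoefficient a b c k := by
  have h1 : (ascPochhammer ℝ k).eval c ≠ 0 := (ascPochhammer_pos k c hc).ne'
  have h2 : c + k ≠ 0 := by positivity
  have h3 : (k.factorial : ℝ) ≠ 0 := by positivity
  simp only [ordinaryHypergeometricCoefficient, ascPochhammer_succ_eval, Nat.factorial_succ]
  push_cast
  field_simp

theorem summable_ordinaryHypergeometricCoefficient (a b : ℝ) {c : ℝ} (hc : 0 < c) {ρ : ℝ}
    (h0 : 0 ≤ ρ) (h1 : ρ < 1) :
    Summable fun k => |ordinaryHypergeometricCoefficient a b c k| * ρ ^ k := by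
  obtain ⟨R, hR, hR1⟩ := exists_between h1
  refine summable_of_ratio_norm_eventually_le hR1 ?_
  have hlim : Filter.Tendsto (fun k : ℕ => |(a + k) / (1 + k) * ((b + k) / (c + k))| * ρ)
      Filter.atTop (nhds (|1 * 1| * ρ)) := by
    refine Filter.Tendsto.mul_const _ (Filter.Tendsto.abs (Filter.Tendsto.mul ?_ ?_))
    · simpa using tendsto_add_mul_div_add_mul_atTop_nhds a 1 (1 : ℝ) one_ne_zero
    · simpa using tendsto_add_mul_div_add_mul_atTop_nhds b c (1 : ℝ) one_ne_zero
  filter_upwards [hlim.eventually (gt_mem_nhds (by simpa using hR))] with k hk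
  have h2 : c + k ≠ 0 := by positivity
  have h3 : (1 : ℝ) + k ≠ 0 := by positivity
  have : ordinaryHypergeometricCoefficient a b c (k + 1) =
      (a + k) / (1 + k) * ((b + k) / (c + k)) * ordinaryHypergeometricCoefficient a b c k := by
    have := ordinaryHypergeometricCoefficient_succ a b hc k
    generalize ordinaryHypergeometricCoefficient a b c = f at this ⊢
    field_simp
    linear_combination this
  rw [this, abs_mul, Real.norm_of_nonneg (by positivity), Real.norm_of_nonneg (by positivity),
    pow_succ]
  have hk' := mul_le_mul_of_nonneg_right hk.le
    (mul_nonneg (abs_nonneg (ordinaryHypergeometricCoefficient a b c k)) (pow_nonneg h0 k))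
  linarith

/-- The hypergeometric differential equation. -/
theorem exists_deriv_ordinaryHypergeometric (a b : ℝ) {c : ℝ} (hc : 0 < c) :
    ∃ F' F'' : ℝ → ℝ, ∀ t : ℝ, |t| < 1 →
      HasDerivAt (₂F₁ a b c : ℝ → ℝ) (F' t) t ∧ HasDerivAt F' (F'' t) t ∧
        t * (1 - t) * F'' t + (c - (a + b + 1) * t) * F' t - a * b * ₂F₁ a b c t = 0 := by
  set f := ordinaryHypergeometricCoefficient a b c with hf
  set g : ℕ → ℝ := fun k => ((k : ℝ) + 1) * f (k + 1) with hg
  set h : ℕ → ℝ := fun k => ((k : ℝ) + 1) * g (k + 1) with hh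
  have sf : ∀ ρ : ℝ, 0 ≤ ρ → ρ < 1 → Summable fun k => |f k| * ρ ^ k := fun ρ h0 h1 =>
    summable_ordinaryHypergeometricCoefficient a b hc h0 h1
  have sg : ∀ ρ : ℝ, 0 ≤ ρ → ρ < 1 → Summable fun k => |g k| * ρ ^ k := fun ρ h0 h1 =>
    summable_powerSeries_deriv sf h0 h1
  have sh : ∀ ρ : ℝ, 0 ≤ ρ → ρ < 1 → Summable fun k => |h k| * ρ ^ k := fun ρ h0 h1 =>
    summable_powerSeries_deriv sg h0 h1
  have hF : (₂F₁ a b c : ℝ → ℝ) = fun t => ∑' k, f k * t ^ k := by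
    rw [ordinaryHypergeometric_eq_tsum]; rfl
  refine ⟨fun t => ∑' k, g k * t ^ k, fun t => ∑' k, h k * t ^ k, fun t ht => ⟨?_, ?_, ?_⟩⟩
  · rw [hF]; exact hasDerivAt_powerSeries sf ht
  · exact hasDerivAt_powerSeries sg ht
  rw [hF]
  have Hf := hasSum_powerSeries sf ht
  have Hg := hasSum_powerSeries sg ht
  have Hh := hasSum_powerSeries sh ht
  set A := ∑' k, f k * t ^ k
  set B := ∑' k, g k * t ^ k
  set C := ∑' k, h k * t ^ k
  -- `H1`, `H2`, `H3` expand tF', tF'' and t²F''. In the combination `H` every coefficient then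
  -- vanishes by the recurrence.
  have H1 : HasSum (fun k : ℕ => k * f k * t ^ k) (t * B) := by
    rw [← hasSum_nat_add_iff' 1]
    convert! Hg.mul_left t using 1
    · funext k; simp [hg]; ring
    · simp
  have H2 : HasSum (fun k : ℕ => k * g k * t ^ k) (t * C) := by
    rw [← hasSum_nat_add_iff' 1]
    convert! Hh.mul_left t using 1
    · funext k; simp [hh]; ring
    · simp
  have H3 : HasSum (fun k : ℕ => ((k : ℝ) - 1) * k * f k * t ^ k) (t * (t * C)) := by
    rw [← hasSum_nat_add_iff' 1]
    convert! H2.mul_left t using 1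
    · funext k; simp [hg]; ring
    · simp
  have H := (((H2.sub H3).add (Hg.mul_left c)).sub (H1.mul_left (a + b + 1))).sub
    (Hf.mul_left (a * b))
  have hz : HasSum (fun _ : ℕ => (0 : ℝ)) 0 := hasSum_zero
  have e := H.unique (hz.congr_fun ?_)
  · show t * (1 - t) * C + (c - (a + b + 1) * t) * B - a * b * A = 0
    linear_combination e
  · intro k
    have := ordinaryHypergeometricCoefficient_succ a b hc k
    simp only [hg]
    rw [← hf] at this
    linear_combination t ^ k * this

/-! ### Rotation invariance of the surface measure -/

theorem isProbabilityMeasure_normSurfaceMeasure {n : ℕ} (hn : 0 < n) :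
    IsProbabilityMeasure (normSurfaceMeasure n) := by
  have : Nonempty (Fin n) := ⟨⟨0, hn⟩⟩
  refine ⟨?_⟩
  have h : (volume : Measure (EuclideanSpace ℝ (Fin n))).toSphere Set.univ ≠ 0 := by
    rw [Ne, Measure.measure_univ_eq_zero]
    exact Measure.toSphere_ne_zero _
  rw [normSurfaceMeasure, Measure.smul_apply, smul_eq_mul]
  exact ENNReal.inv_mul_cancel h (measure_ne_top _ _)

/-- The action of a linear isometry on the unit sphere. -/
def LinearIsometryEquiv.unitSphereHomeomorph {E : Type*} [NormedAddCommGroup E] [NormedSpace ℝ E]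
    (L : E ≃ₗᵢ[ℝ] E) : sphere (0 : E) 1 ≃ₜ sphere (0 : E) 1 where
  toFun η := ⟨L η, by simp⟩
  invFun η := ⟨L.symm η, by simp⟩
  left_inv η := by simp
  right_inv η := by simp
  continuous_toFun := (L.continuous.comp continuous_subtype_val).subtype_mk _
  continuous_invFun := (L.symm.continuous.comp continuous_subtype_val).subtype_mk _

open scoped Pointwise in
-- The surface measure of s is, up to a constant, the volume of the cone (0,1)·s. An isometry maps
-- cones to cones and preserves volume.
theorem measurePreserving_unitSphereHomeomorph {n : ℕ}
    (L : EuclideanSpace ℝ (Fin n) ≃ₗᵢ[ℝ] EuclideanSpace ℝ (Fin n)) :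
    MeasurePreserving L.unitSphereHomeomorph.toMeasurableEquiv (normSurfaceMeasure n)
      (normSurfaceMeasure n) := by
  refine ⟨L.unitSphereHomeomorph.toMeasurableEquiv.measurable, ?_⟩
  rw [normSurfaceMeasure, Measure.map_smul]
  congr 1
  ext s hs
  have hm : Measurable L.unitSphereHomeomorph.toMeasurableEquiv :=
    L.unitSphereHomeomorph.toMeasurableEquiv.measurable
  rw [Measure.map_apply hm hs, Measure.toSphere_apply' _ (hm hs), Measure.toSphere_apply' _ hs]
  congr 1
  have : Set.Ioo (0 : ℝ) 1 • (Subtype.val ''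
      (L.unitSphereHomeomorph.toMeasurableEquiv ⁻¹' s) : Set (EuclideanSpace ℝ (Fin n))) =
      L.toHomeomorph.toMeasurableEquiv ⁻¹' (Set.Ioo (0 : ℝ) 1 • (Subtype.val '' s)) := by
    ext y
    simp only [Set.mem_smul, Set.mem_image, Set.mem_preimage]
    constructor
    · rintro ⟨r, hr, _, ⟨η, hη, rfl⟩, rfl⟩
      exact ⟨r, hr, L η, ⟨_, hη, rfl⟩, (L.map_smul r η).symm⟩
    · rintro ⟨r, hr, _, ⟨η, hη, rfl⟩, h⟩
      refine ⟨r, hr, L.symm η, ⟨L.unitSphereHomeomorph.symm η, ?_, rfl⟩, ?_⟩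
      · simpa using hη
      · apply L.injective
        rw [L.map_smul, L.apply_symm_apply]
        exact h
  rw [this]
  exact (L.measurePreserving : MeasurePreserving L.toHomeomorph.toMeasurableEquiv volume
    volume).measure_preimage_equiv _

theorem integral_normSurfaceMeasure_comp {n : ℕ}
    (L : EuclideanSpace ℝ (Fin n) ≃ₗᵢ[ℝ] EuclideanSpace ℝ (Fin n))
    (f : EuclideanSpace ℝ (Fin n) → ℝ) :
    ∫ η, f (L η) ∂(normSurfaceMeasure n) = ∫ η, f η ∂(normSurfaceMeasure n) :=
  (measurePreserving_unitSphereHomeomorph L).integral_comp'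
    (fun η : sphere (0 : EuclideanSpace ℝ (Fin n)) 1 => f η)

/-! ### Calculus under the integral and on the sphere -/

theorem Continuous.integrable_of_compactSpace {S : Type*} [TopologicalSpace S] [CompactSpace S]
    [MeasurableSpace S] [OpensMeasurableSpace S] {μ : Measure S} [IsFiniteMeasure μ] {f : S → ℝ}
    (hf : Continuous f) : Integrable f μ :=
  hf.integrable_of_hasCompactSupport (HasCompactSupport.of_compactSpace f)

/-- Compactness of S times a closed ball around r₀ provides a constant dominating F'. -/
theorem hasDerivAt_integral_of_continuousOn {S : Type*} [TopologicalSpace S] [CompactSpace S]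
    [MeasurableSpace S] [OpensMeasurableSpace S] {μ : Measure S} [IsFiniteMeasure μ]
    {F F' : ℝ → S → ℝ} {U : Set ℝ} (hU : IsOpen U) (hF : ∀ r ∈ U, Continuous (F r))
    (hF' : ContinuousOn (fun z : ℝ × S => F' z.1 z.2) (U ×ˢ Set.univ))
    (hd : ∀ r ∈ U, ∀ s, HasDerivAt (fun r => F r s) (F' r s) r) {r₀ : ℝ} (hr₀ : r₀ ∈ U) :
    HasDerivAt (fun r => ∫ s, F r s ∂μ) (∫ s, F' r₀ s ∂μ) r₀ := by
  obtain ⟨ε, hε, hεU⟩ := Metric.nhds_basis_closedBall.mem_iff.1 (hU.mem_nhds hr₀)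
  have hK : IsCompact (closedBall r₀ ε ×ˢ (Set.univ : Set S)) :=
    (isCompact_closedBall _ _).prod isCompact_univ
  obtain ⟨C, hC⟩ := hK.exists_bound_of_continuousOn
    (hF'.mono (Set.prod_mono hεU subset_rfl))
  have hc : Continuous (F' r₀) := by
    have : ContinuousOn (fun s : S => F' r₀ s) Set.univ :=
      hF'.comp (f := fun s : S => (r₀, s)) (by fun_prop) fun s _ => ⟨hr₀, trivial⟩
    exact continuousOn_univ.1 this
  refine (hasDerivAt_integral_of_dominated_loc_of_deriv_le (bound := fun _ => C)
    (closedBall_mem_nhds r₀ hε) ?_ (hF r₀ hr₀).integrable_of_compactSpace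
    hc.aestronglyMeasurable ?_ (integrable_const C) ?_).2
  · filter_upwards [hU.mem_nhds hr₀] with r hr using (hF r hr).aestronglyMeasurable
  · exact .of_forall fun s r hr => hC (r, s) ⟨hr, trivial⟩
  · exact .of_forall fun s r hr => hd r (hεU hr) s

theorem inner_sphere_mem_Icc {n : ℕ} {e : EuclideanSpace ℝ (Fin n)} (he : ‖e‖ = 1)
    (η : sphere (0 : EuclideanSpace ℝ (Fin n)) 1) : inner ℝ e (η : EuclideanSpace ℝ (Fin n)) ∈
      Set.Icc (-1 : ℝ) 1 := by
  have := abs_real_inner_le_norm e (η : EuclideanSpace ℝ (Fin n))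
  rw [he, norm_eq_of_mem_sphere η, one_mul] at this
  exact abs_le.1 this

theorem norm_cos_smul_add_sin_smul {E : Type*} [NormedAddCommGroup E] [InnerProductSpace ℝ E]
    {e w : E} (he : ‖e‖ = 1) (hw : ‖w‖ = 1) (hew : inner ℝ e w = 0) (θ : ℝ) :
    ‖Real.cos θ • e + Real.sin θ • w‖ = 1 := by
  have : ‖Real.cos θ • e + Real.sin θ • w‖ ^ 2 = 1 := by
    rw [norm_add_sq_real, norm_smul, norm_smul, he, hw, inner_smul_left, inner_smul_right, hew]
    simp
  nlinarith [norm_nonneg (Real.cos θ • e + Real.sin θ • w)]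

/-- The reflection in the hyperplane orthogonal to w fixes v and negates w, so the integrand is odd
under it. -/
theorem integral_inner_mul_inner_eq_zero {n : ℕ} {v w : EuclideanSpace ℝ (Fin n)}
    (hvw : inner ℝ v w = 0) (ψ : ℝ → ℝ) :
    ∫ η, ψ (inner ℝ v (η : EuclideanSpace ℝ (Fin n))) *
      inner ℝ w (η : EuclideanSpace ℝ (Fin n)) ∂(normSurfaceMeasure n) = 0 := by
  set L := (ℝ ∙ w)ᗮ.reflection
  have hL : ∀ y z, inner ℝ (L y) (L z) = inner ℝ y z := L.inner_map_map
  have hv : L v = v := Submodule.reflection_mem_subspace_eq_self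
    (Submodule.mem_orthogonal_singleton_iff_inner_left.2 hvw)
  have hw : L w = -w := Submodule.reflection_orthogonalComplement_singleton_eq_neg w
  have key := integral_normSurfaceMeasure_comp L fun y => ψ (inner ℝ v y) * inner ℝ w y
  have h1 : ∀ y, inner ℝ v (L y) = inner ℝ v y := fun y => by
    conv_lhs => rw [← hv]
    exact hL v y
  have h2 : ∀ y, inner ℝ w (L y) = -inner ℝ w y := fun y => by
    rw [← hL w y, hw, inner_neg_left, neg_neg]
  simp only [h1, h2, mul_neg, integral_neg] at key
  linarith

/-- Rotate the pair (e, w) by θ in its plane: the integral of ψ(A θ) B θ vanishes for all θ by the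
preceding symmetry. Its θ-derivative at 0 is the difference of the two sides, since A' = B and B' =
-A. -/
theorem integral_inner_sq_mul_deriv {n : ℕ} (hn : 0 < n) {e w : EuclideanSpace ℝ (Fin n)}
    (he : ‖e‖ = 1) (hw : ‖w‖ = 1) (hew : inner ℝ e w = 0) {ψ ψ' : ℝ → ℝ}
    (hψ : ∀ s ∈ Set.Icc (-1 : ℝ) 1, HasDerivAt ψ (ψ' s) s)
    (hψ' : ContinuousOn ψ' (Set.Icc (-1 : ℝ) 1)) :
    ∫ η, ψ' (inner ℝ e (η : EuclideanSpace ℝ (Fin n))) *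
        inner ℝ w (η : EuclideanSpace ℝ (Fin n)) ^ 2 ∂(normSurfaceMeasure n) =
      ∫ η, ψ (inner ℝ e (η : EuclideanSpace ℝ (Fin n))) *
        inner ℝ e (η : EuclideanSpace ℝ (Fin n)) ∂(normSurfaceMeasure n) := by
  have := isProbabilityMeasure_normSurfaceMeasure hn
  have hψc : ContinuousOn ψ (Set.Icc (-1 : ℝ) 1) := fun s hs =>
    (hψ s hs).continuousAt.continuousWithinAt
  let a : sphere (0 : EuclideanSpace ℝ (Fin n)) 1 → ℝ := fun η =>
    inner ℝ e (η : EuclideanSpace ℝ (Fin n))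
  let b : sphere (0 : EuclideanSpace ℝ (Fin n)) 1 → ℝ := fun η =>
    inner ℝ w (η : EuclideanSpace ℝ (Fin n))
  have ha : Continuous a := by fun_prop
  have hb : Continuous b := by fun_prop
  let A : ℝ → sphere (0 : EuclideanSpace ℝ (Fin n)) 1 → ℝ := fun θ η =>
    Real.cos θ * a η + Real.sin θ * b η
  let B : ℝ → sphere (0 : EuclideanSpace ℝ (Fin n)) 1 → ℝ := fun θ η =>
    -Real.sin θ * a η + Real.cos θ * b η
  have hA : ∀ θ η, A θ η = inner ℝ (Real.cos θ • e + Real.sin θ • w)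
      (η : EuclideanSpace ℝ (Fin n)) := fun θ η => by
    simp [A, a, b, inner_add_left, inner_smul_left]
  have hB : ∀ θ η, B θ η = inner ℝ (-Real.sin θ • e + Real.cos θ • w)
      (η : EuclideanSpace ℝ (Fin n)) := fun θ η => by
    simp [B, a, b, inner_add_left, inner_smul_left]
  have hAI : ∀ θ η, A θ η ∈ Set.Icc (-1 : ℝ) 1 := fun θ η => by
    rw [hA]; exact inner_sphere_mem_Icc (norm_cos_smul_add_sin_smul he hw hew θ) η
  have hAc : Continuous fun z : ℝ × sphere (0 : EuclideanSpace ℝ (Fin n)) 1 => A z.1 z.2 := by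
    fun_prop
  have hBc : Continuous fun z : ℝ × sphere (0 : EuclideanSpace ℝ (Fin n)) 1 => B z.1 z.2 := by
    fun_prop
  have hψA : Continuous fun z : ℝ × sphere (0 : EuclideanSpace ℝ (Fin n)) 1 => ψ (A z.1 z.2) :=
    hψc.comp_continuous hAc fun z => hAI _ _
  have hψ'A : Continuous fun z : ℝ × sphere (0 : EuclideanSpace ℝ (Fin n)) 1 => ψ' (A z.1 z.2) :=
    hψ'.comp_continuous hAc fun z => hAI _ _
  have hJ : ∀ θ, ∫ η, ψ (A θ η) * B θ η ∂(normSurfaceMeasure n) = 0 := fun θ => by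
    simp only [hA, hB]
    refine integral_inner_mul_inner_eq_zero ?_ ψ
    simp only [inner_add_left, inner_add_right, inner_smul_left, inner_smul_right, hew,
      real_inner_comm e w, real_inner_self_eq_norm_sq, he, hw]
    simp
    ring
  have hd := hasDerivAt_integral_of_continuousOn (μ := normSurfaceMeasure n)
    (F := fun θ η => ψ (A θ η) * B θ η)
    (F' := fun θ η => ψ' (A θ η) * B θ η * B θ η + ψ (A θ η) * (-A θ η))
    isOpen_univ (fun θ _ => ((hψA.mul hBc).comp (Continuous.prodMk_right θ)))
    (((hψ'A.mul hBc).mul hBc).add (hψA.mul hAc.neg)).continuousOn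
    (fun θ _ η => ?_) (Set.mem_univ 0)
  · simp only [hJ] at hd
    have h0 := hd.unique (hasDerivAt_const _ _)
    have hc : ∀ f : ℝ × sphere (0 : EuclideanSpace ℝ (Fin n)) 1 → ℝ, Continuous f →
        Integrable (fun η => f (0, η)) (normSurfaceMeasure n) := fun f hf =>
      (hf.comp (Continuous.prodMk_right 0)).integrable_of_compactSpace
    rw [integral_add (f := fun η => ψ' (A 0 η) * B 0 η * B 0 η) (g := fun η => ψ (A 0 η) * (-A 0 η))
      (hc _ ((hψ'A.mul hBc).mul hBc)) (hc _ (hψA.mul hAc.neg))] at h0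
    simp only [A, B, Real.cos_zero, Real.sin_zero, neg_zero, zero_mul, one_mul, zero_add, add_zero,
      mul_neg, integral_neg] at h0
    simp only [pow_two, ← mul_assoc]
    linarith
  · have hAd : HasDerivAt (fun θ => A θ η) (B θ η) θ :=
      ((Real.hasDerivAt_cos θ).mul_const _).add ((Real.hasDerivAt_sin θ).mul_const _)
    have hBd : HasDerivAt (fun θ => B θ η) (-A θ η) θ := by
      convert! ((Real.hasDerivAt_sin θ).neg.mul_const (a η)).add
        ((Real.hasDerivAt_cos θ).mul_const (b η)) using 1
      simp only [A]; ring
    exact ((hψ _ (hAI θ η)).comp θ hAd).mul hBd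

/-- Integration by parts for zonal functions on the sphere. -/
theorem integral_zonal_by_parts {n : ℕ} (b : OrthonormalBasis (Fin n) ℝ (EuclideanSpace ℝ (Fin n)))
    (i : Fin n) {ψ ψ' : ℝ → ℝ}
    (hψ : ∀ s ∈ Set.Icc (-1 : ℝ) 1, HasDerivAt ψ (ψ' s) s)
    (hψ' : ContinuousOn ψ' (Set.Icc (-1 : ℝ) 1)) :
    ∫ η, ψ' (inner ℝ (b i) (η : EuclideanSpace ℝ (Fin n))) *
        (1 - inner ℝ (b i) (η : EuclideanSpace ℝ (Fin n)) ^ 2) ∂(normSurfaceMeasure n) =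
      ((n : ℝ) - 1) * ∫ η, ψ (inner ℝ (b i) (η : EuclideanSpace ℝ (Fin n))) *
        inner ℝ (b i) (η : EuclideanSpace ℝ (Fin n)) ∂(normSurfaceMeasure n) := by
  have hn : 0 < n := i.pos
  have := isProbabilityMeasure_normSurfaceMeasure hn
  -- Each of the n - 1 directions orthogonal to `b i` contributes the same integral, whence the
  -- factor n - 1.
  have hsum : ∀ η : sphere (0 : EuclideanSpace ℝ (Fin n)) 1,
      1 - inner ℝ (b i) (η : EuclideanSpace ℝ (Fin n)) ^ 2 =
        ∑ j ∈ Finset.univ.erase i, inner ℝ (b j) (η : EuclideanSpace ℝ (Fin n)) ^ 2 := fun η => by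
    have := b.sum_sq_norm_inner_right (η : EuclideanSpace ℝ (Fin n))
    simp only [Real.norm_eq_abs, sq_abs, norm_eq_of_mem_sphere η, one_pow] at this
    rw [← Finset.add_sum_erase _ _ (Finset.mem_univ i)] at this
    linarith
  have hc : Continuous fun η : sphere (0 : EuclideanSpace ℝ (Fin n)) 1 =>
      ψ' (inner ℝ (b i) (η : EuclideanSpace ℝ (Fin n))) :=
    hψ'.comp_continuous (by fun_prop) fun η => inner_sphere_mem_Icc (b.norm_eq_one i) η
  simp only [hsum, Finset.mul_sum]
  have hint : ∀ j, Integrable (fun η : sphere (0 : EuclideanSpace ℝ (Fin n)) 1 =>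
      ψ' (inner ℝ (b i) (η : EuclideanSpace ℝ (Fin n))) *
        inner ℝ (b j) (η : EuclideanSpace ℝ (Fin n)) ^ 2) (normSurfaceMeasure n) := fun j =>
    (hc.mul (by fun_prop)).integrable_of_compactSpace
  rw [integral_finsetSum _ fun j _ => hint j]
  rw [Finset.sum_congr rfl fun j hj => integral_inner_sq_mul_deriv hn (b.norm_eq_one i)
    (b.norm_eq_one j) (b.inner_eq_zero (Finset.ne_of_mem_erase hj).symm) hψ hψ']
  rw [Finset.sum_const, Finset.card_erase_of_mem (Finset.mem_univ i), Finset.card_univ,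
    Fintype.card_fin, nsmul_eq_mul, Nat.cast_pred hn]

/-! ### The singular radial equation and its two solutions -/

theorem eq_of_singular_ode {N : ℕ} (hN : 0 < N) {κ M : ℝ} {u u' u'' v v' v'' : ℝ → ℝ}
    (hu : ∀ r ∈ Set.Ico (0 : ℝ) 1, HasDerivAt u (u' r) r)
    (hu' : ∀ r ∈ Set.Ico (0 : ℝ) 1, HasDerivAt u' (u'' r) r)
    (hv : ∀ r ∈ Set.Ico (0 : ℝ) 1, HasDerivAt v (v' r) r)
    (hv' : ∀ r ∈ Set.Ico (0 : ℝ) 1, HasDerivAt v' (v'' r) r)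
    (hou : ∀ r ∈ Set.Ico (0 : ℝ) 1,
      (1 - r ^ 2) * (r * u'' r + N * u' r) = 2 * κ * r ^ 2 * u' r + M * r * u r)
    (hov : ∀ r ∈ Set.Ico (0 : ℝ) 1,
      (1 - r ^ 2) * (r * v'' r + N * v' r) = 2 * κ * r ^ 2 * v' r + M * r * v r)
    (hpos : ∀ r ∈ Set.Ico (0 : ℝ) 1, 0 < u r) (h0 : u 0 = v 0) {r : ℝ}
    (hr : r ∈ Set.Ico (0 : ℝ) 1) : u r = v r := by
  obtain ⟨m, rfl⟩ : ∃ m, N = m + 1 := ⟨N - 1, by omega⟩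
  set W : ℝ → ℝ := fun r => u r * v' r - v r * u' r with hW
  have hWd : ∀ r ∈ Set.Ico (0 : ℝ) 1, HasDerivAt W (u r * v'' r - v r * u'' r) r := by
    intro r hr
    convert! ((hu r hr).mul (hv' r hr)).sub ((hv r hr).mul (hu' r hr)) using 1
    ring
  have hw : ∀ r ∈ Set.Ico (0 : ℝ) 1, 0 < 1 - r ^ 2 := fun r hr => by nlinarith [hr.1, hr.2]
  -- Abel's formula: the weight r^N (1 - r²)^κ is the integrating factor of the first-order terms.
  -- It vanishes at 0 because N > 0, hence so does the constant `Z`.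
  set Z : ℝ → ℝ := fun r => r ^ (m + 1) * (1 - r ^ 2) ^ κ * W r with hZ
  have hZd : ∀ r ∈ Set.Ico (0 : ℝ) 1, HasDerivAt Z 0 r := by
    intro r hr
    have hwr := hw r hr
    have h1 : HasDerivAt (fun r : ℝ => 1 - r ^ 2) (-(2 * r)) r := by
      simpa using (hasDerivAt_pow 2 r).const_sub 1
    convert! ((hasDerivAt_pow (m + 1) r).mul (h1.rpow_const (p := κ) (Or.inl hwr.ne'))).mul
      (hWd r hr) using 1
    have h2 : (1 - r ^ 2) ^ κ = (1 - r ^ 2) ^ (κ - 1) * (1 - r ^ 2) := by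
      rw [← Real.rpow_add_one hwr.ne']; ring_nf
    have hou := hou r hr
    have hov := hov r hr
    simp only [hW, Pi.mul_apply, h2, pow_succ r m, Nat.add_sub_cancel]
    push_cast at hou hov ⊢
    linear_combination (r ^ m * (1 - r ^ 2) ^ (κ - 1)) * (v r * hou - u r * hov)
  have hW0 : ∀ r ∈ Set.Ico (0 : ℝ) 1, W r = 0 := by
    intro r hr
    rcases hr.1.eq_or_lt with rfl | hr0
    · have a := hou 0 hr
      have b := hov 0 hr
      have hm : ((m : ℝ) + 1) ≠ 0 := by positivity
      push_cast at a b
      have a' : u' 0 = 0 := by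
        apply mul_left_cancel₀ hm; linarith
      have b' : v' 0 = 0 := by
        apply mul_left_cancel₀ hm; linarith
      simp [hW, a', b']
    · have hsub : Set.Icc 0 r ⊆ Set.Ico (0 : ℝ) 1 := fun y hy => ⟨hy.1, hy.2.trans_lt hr.2⟩
      have := constant_of_has_deriv_right_zero (f := Z) (a := 0) (b := r)
        (fun y hy => (hZd y (hsub hy)).continuousAt.continuousWithinAt)
        (fun y hy => (hZd y (hsub (Set.Ico_subset_Icc_self hy))).hasDerivWithinAt) r
        ⟨hr.1, le_rfl⟩
      have hne : r ^ (m + 1) * (1 - r ^ 2) ^ κ ≠ 0 :=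
        mul_ne_zero (by positivity) (Real.rpow_pos_of_pos (hw r hr) _).ne'
      simp only [hZ, zero_pow (Nat.succ_ne_zero m), zero_mul] at this
      exact (mul_eq_zero.1 this).resolve_left hne
  have hq : ∀ y ∈ Set.Ico (0 : ℝ) 1, HasDerivAt (fun y => v y / u y) 0 y := by
    intro y hy
    convert! (hv y hy).div (hu y hy) (hpos y hy).ne' using 1
    have := hW0 y hy
    simp only [hW] at this
    rw [show v' y * u y - v y * u' y = 0 by linarith, zero_div]
  have hsub : Set.Icc 0 r ⊆ Set.Ico (0 : ℝ) 1 := fun y hy => ⟨hy.1, hy.2.trans_lt hr.2⟩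
  have := constant_of_has_deriv_right_zero (f := fun y => v y / u y) (a := 0) (b := r)
    (fun y hy => (hq y (hsub hy)).continuousAt.continuousWithinAt)
    (fun y hy => (hq y (hsub (Set.Ico_subset_Icc_self hy))).hasDerivWithinAt) r
    ⟨hr.1, le_rfl⟩
  have hu0 := (hpos 0 (by simp)).ne'
  simp only [← h0, div_self hu0] at this
  exact ((div_eq_one_iff_eq (hpos r hr).ne').1 this).symm

/-- The exponent n - 1 - 2l is c - a - b for the Euler-transformed parameters a = l, b = l + 1 -
n/2, c = n/2. After the substitution t = r² the radial equation is a multiple of the hypergeometric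
one. -/
theorem exists_deriv_rpow_mul_ordinaryHypergeometric (n l : ℝ) (hn : 0 < n) :
    ∃ v' v'' : ℝ → ℝ, ∀ r ∈ Set.Ico (0 : ℝ) 1,
      HasDerivAt (fun r : ℝ => (1 - r ^ 2) ^ (n - 1 - 2 * l) *
        ₂F₁ (n / 2 - l) (n - 1 - l) (n / 2) (r ^ 2)) (v' r) r ∧ HasDerivAt v' (v'' r) r ∧
      (1 - r ^ 2) * (r * v'' r + (n - 1) * v' r) = 2 * (2 * l + 2 - n) * r ^ 2 * v' r +
        2 * (2 * l + 2 - n) * l * r * ((1 - r ^ 2) ^ (n - 1 - 2 * l) *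
          ₂F₁ (n / 2 - l) (n - 1 - l) (n / 2) (r ^ 2)) := by
  obtain ⟨F', F'', hF⟩ := exists_deriv_ordinaryHypergeometric (n / 2 - l) (n - 1 - l)
    (c := n / 2) (by positivity)
  set F : ℝ → ℝ := ₂F₁ (n / 2 - l) (n - 1 - l) (n / 2)
  set μ := n - 1 - 2 * l with hμ
  refine ⟨fun r => 2 * r * ((1 - r ^ 2) ^ μ * F' (r ^ 2)) -
      2 * μ * r * ((1 - r ^ 2) ^ (μ - 1) * F (r ^ 2)),
    fun r => 2 * ((1 - r ^ 2) ^ μ * F' (r ^ 2)) + 2 * r * (-(2 * r) * μ * (1 - r ^ 2) ^ (μ - 1) *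
      F' (r ^ 2) + (1 - r ^ 2) ^ μ * (F'' (r ^ 2) * (2 * r))) -
      (2 * μ * ((1 - r ^ 2) ^ (μ - 1) * F (r ^ 2)) + 2 * μ * r * (-(2 * r) * (μ - 1) *
      (1 - r ^ 2) ^ (μ - 1 - 1) * F (r ^ 2) + (1 - r ^ 2) ^ (μ - 1) * (F' (r ^ 2) * (2 * r)))),
    fun r hr => ?_⟩
  have hw : 0 < 1 - r ^ 2 := by nlinarith [hr.1, hr.2]
  obtain ⟨hd1, hd2, ho⟩ := hF (r ^ 2) (by rw [abs_of_nonneg (sq_nonneg r)]; linarith)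
  have hsq : HasDerivAt (fun r : ℝ => r ^ 2) (2 * r) r := by simpa using hasDerivAt_pow 2 r
  have h1 : HasDerivAt (fun r : ℝ => 1 - r ^ 2) (-(2 * r)) r := hsq.const_sub 1
  have hp : ∀ p : ℝ, HasDerivAt (fun r : ℝ => (1 - r ^ 2) ^ p)
      (-(2 * r) * p * (1 - r ^ 2) ^ (p - 1)) r := fun p => h1.rpow_const (Or.inl hw.ne')
  have hFd : HasDerivAt (fun r : ℝ => F (r ^ 2)) (F' (r ^ 2) * (2 * r)) r :=
    HasDerivAt.comp (h₂ := F) (h := fun r => r ^ 2) r hd1 hsq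
  have hFd' : HasDerivAt (fun r : ℝ => F' (r ^ 2)) (F'' (r ^ 2) * (2 * r)) r :=
    HasDerivAt.comp (h₂ := F') (h := fun r => r ^ 2) r hd2 hsq
  refine ⟨?_, ?_, ?_⟩
  · convert! (hp μ).mul hFd using 1
    ring
  · convert! (((hasDerivAt_id r).const_mul 2).mul ((hp μ).mul hFd')).sub
      (((hasDerivAt_id r).const_mul (2 * μ)).mul ((hp (μ - 1)).mul hFd)) using 1
    simp
  · have e1 : (1 - r ^ 2) ^ (μ - 1) = (1 - r ^ 2) ^ (μ - 1 - 1) * (1 - r ^ 2) := by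
      rw [← Real.rpow_add_one hw.ne']; ring_nf
    have e2 : (1 - r ^ 2) ^ μ = (1 - r ^ 2) ^ (μ - 1 - 1) * (1 - r ^ 2) * (1 - r ^ 2) := by
      rw [← e1, ← Real.rpow_add_one hw.ne']; ring_nf
    dsimp only
    rw [e2, e1]
    generalize (1 - r ^ 2) ^ (μ - 1 - 1) = P
    rw [hμ]
    linear_combination (4 * r * P * (1 - r ^ 2) ^ 2) * ho

theorem one_add_sq_sub_pos {r s : ℝ} (hr : r ∈ Set.Ioo (-1 : ℝ) 1) (hs : s ∈ Set.Icc (-1 : ℝ) 1) :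
    0 < 1 + r ^ 2 - 2 * r * s := by
  obtain ⟨h1, h2⟩ := hr
  obtain ⟨h3, h4⟩ := hs
  rcases le_total 0 r with h | h
  · nlinarith [mul_nonneg h (sub_nonneg.2 h4)]
  · nlinarith [mul_nonneg (neg_nonneg.2 h) (by linarith : 0 ≤ s + 1)]

theorem integral_pos_of_continuous_pos {S : Type*} [TopologicalSpace S] [CompactSpace S]
    [MeasurableSpace S] [OpensMeasurableSpace S] {μ : Measure S} [IsProbabilityMeasure μ]
    {f : S → ℝ} (hf : Continuous f) (hpos : ∀ s, 0 < f s) : 0 < ∫ s, f s ∂μ := by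
  rw [integral_pos_iff_support_of_nonneg (fun s => (hpos s).le) hf.integrable_of_compactSpace,
    Set.eq_univ_of_forall (s := Function.support f) fun s => (hpos s).ne']
  simp

/-- The function and its two derivatives are combinations of three integrals `A`, `S`, `T`.
Integration by parts links `S` and `T`, and the equation is a multiple of that link. The interval
reaches below 0 so that r = 0 has two-sided derivatives. -/
theorem exists_deriv_integral_zonal_rpow {n : ℕ}
    (b : OrthonormalBasis (Fin n) ℝ (EuclideanSpace ℝ (Fin n))) (i : Fin n) (l : ℝ) :
    ∃ g' g'' : ℝ → ℝ, ∀ r ∈ Set.Ioo (-1 : ℝ) 1,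
      HasDerivAt (fun r : ℝ => ∫ η, (1 + r ^ 2 - 2 * r *
        inner ℝ (b i) (η : EuclideanSpace ℝ (Fin n))) ^ (-l) ∂(normSurfaceMeasure n)) (g' r) r ∧
      HasDerivAt g' (g'' r) r ∧
      (1 - r ^ 2) * (r * g'' r + (n - 1) * g' r) = 2 * (2 * l + 2 - n) * r ^ 2 * g' r +
        2 * (2 * l + 2 - n) * l * r * ∫ η, (1 + r ^ 2 - 2 * r *
        inner ℝ (b i) (η : EuclideanSpace ℝ (Fin n))) ^ (-l) ∂(normSurfaceMeasure n) := by
  have := isProbabilityMeasure_normSurfaceMeasure i.pos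
  let s : sphere (0 : EuclideanSpace ℝ (Fin n)) 1 → ℝ := fun η =>
    inner ℝ (b i) (η : EuclideanSpace ℝ (Fin n))
  have hs : Continuous s := by fun_prop
  have hsI : ∀ η, s η ∈ Set.Icc (-1 : ℝ) 1 := fun η => inner_sphere_mem_Icc (b.norm_eq_one i) η
  let D : ℝ → sphere (0 : EuclideanSpace ℝ (Fin n)) 1 → ℝ := fun r η => 1 + r ^ 2 - 2 * r * s η
  have hD : ∀ r ∈ Set.Ioo (-1 : ℝ) 1, ∀ η, 0 < D r η := fun r hr η =>
    one_add_sq_sub_pos hr (hsI η)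
  have hDc : ∀ m : ℝ, ContinuousOn (fun z : ℝ × sphere (0 : EuclideanSpace ℝ (Fin n)) 1 =>
      D z.1 z.2 ^ m) (Set.Ioo (-1 : ℝ) 1 ×ˢ Set.univ) := fun m =>
    ContinuousOn.rpow_const (Continuous.continuousOn (by fun_prop))
      fun z hz => Or.inl (hD _ hz.1 _).ne'
  have hDr : ∀ m : ℝ, ∀ r ∈ Set.Ioo (-1 : ℝ) 1, Continuous fun η => D r η ^ m := fun m r hr =>
    Continuous.rpow_const (by fun_prop) fun η => Or.inl (hD r hr η).ne'
  have hDd : ∀ m : ℝ, ∀ r ∈ Set.Ioo (-1 : ℝ) 1, ∀ η,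
      HasDerivAt (fun r => D r η ^ m) (2 * (r - s η) * m * D r η ^ (m - 1)) r := fun m r hr η => by
    have h1 : HasDerivAt (fun r => D r η) (2 * (r - s η)) r := by
      convert! ((hasDerivAt_pow 2 r).const_add 1).sub
        (((hasDerivAt_id r).const_mul 2).mul_const (s η)) using 1
      simp; ring
    exact h1.rpow_const (Or.inl (hD r hr η).ne')
  refine ⟨fun r => ∫ η, 2 * (r - s η) * (-l) * D r η ^ (-l - 1) ∂(normSurfaceMeasure n),
    fun r => ∫ η, (2 * (-l) * D r η ^ (-l - 1) + 2 * (r - s η) * (-l) *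
      (2 * (r - s η) * (-l - 1) * D r η ^ (-l - 1 - 1))) ∂(normSurfaceMeasure n),
    fun r hr => ⟨?_, ?_, ?_⟩⟩
  · refine hasDerivAt_integral_of_continuousOn (F := fun r η => D r η ^ (-l))
      (F' := fun r η => 2 * (r - s η) * (-l) * D r η ^ (-l - 1)) isOpen_Ioo (hDr _)
      (ContinuousOn.mul (Continuous.continuousOn (by fun_prop)) (hDc _)) (hDd _) hr
  · refine hasDerivAt_integral_of_continuousOn
      (F := fun r η => 2 * (r - s η) * (-l) * D r η ^ (-l - 1))
      (F' := fun r η => 2 * (-l) * D r η ^ (-l - 1) + 2 * (r - s η) * (-l) *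
        (2 * (r - s η) * (-l - 1) * D r η ^ (-l - 1 - 1))) isOpen_Ioo
      (fun r hr => Continuous.mul (by fun_prop) (hDr _ r hr))
      (((Continuous.continuousOn (by fun_prop)).mul (hDc _)).add
        ((Continuous.continuousOn (by fun_prop)).mul
          ((Continuous.continuousOn (by fun_prop)).mul (hDc _)))) (fun r hr η => ?_) hr
    convert! ((((hasDerivAt_id r).sub_const (s η)).const_mul 2).mul_const (-l)).mul
      (hDd (-l - 1) r hr η) using 1
    simp
  · have e1 : ∀ η, D r η ^ (-l - 1) = D r η ^ (-l - 1 - 1) * D r η := fun η => by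
      rw [← Real.rpow_add_one (hD r hr η).ne']; ring_nf
    have e2 : ∀ η, D r η ^ (-l) = D r η ^ (-l - 1) * D r η := fun η => by
      rw [← Real.rpow_add_one (hD r hr η).ne']; ring_nf
    have hint : ∀ m : ℝ, ∀ f : sphere (0 : EuclideanSpace ℝ (Fin n)) 1 → ℝ, Continuous f →
        Integrable (fun η => f η * D r η ^ m) (normSurfaceMeasure n) := fun m f hf =>
      (hf.mul (hDr m r hr)).integrable_of_compactSpace
    have hz := integral_zonal_by_parts b i (ψ := fun s => (1 + r ^ 2 - 2 * r * s) ^ (-l - 1))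
      (ψ' := fun s => -(2 * r) * (-l - 1) * (1 + r ^ 2 - 2 * r * s) ^ (-l - 1 - 1))
      (fun s hs => by
        have h1 : HasDerivAt (fun s => 1 + r ^ 2 - 2 * r * s) (-(2 * r)) s := by
          simpa using ((hasDerivAt_id s).const_mul (2 * r)).const_sub (1 + r ^ 2)
        exact h1.rpow_const (Or.inl (one_add_sq_sub_pos hr hs).ne'))
      (ContinuousOn.mul (Continuous.continuousOn (by fun_prop))
        (ContinuousOn.rpow_const (Continuous.continuousOn (by fun_prop))
          fun s hs => Or.inl (one_add_sq_sub_pos hr hs).ne'))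
    set A := ∫ η, D r η ^ (-l - 1) ∂(normSurfaceMeasure n)
    set S := ∫ η, s η * D r η ^ (-l - 1) ∂(normSurfaceMeasure n)
    set T := ∫ η, (1 - s η ^ 2) * D r η ^ (-l - 1 - 1) ∂(normSurfaceMeasure n)
    have hA : Integrable (fun η => D r η ^ (-l - 1)) (normSurfaceMeasure n) :=
      (hDr _ r hr).integrable_of_compactSpace
    have hS := hint (-l - 1) s hs
    have hT := hint (-l - 1 - 1) (fun η => 1 - s η ^ 2) (by fun_prop)
    have hz' : -(2 * r) * (-l - 1) * T = (n - 1) * S := by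
      rw [← integral_const_mul]
      refine (integral_congr_ae (.of_forall fun η => ?_)).trans (hz.trans ?_)
      · simp only [D, s]; ring
      · congr 1
        exact integral_congr_ae (.of_forall fun η => mul_comm _ _)
    have E0 : ∫ η, (1 + r ^ 2 - 2 * r * inner ℝ (b i) (η : EuclideanSpace ℝ (Fin n))) ^ (-l)
        ∂(normSurfaceMeasure n) = (1 + r ^ 2) * A - 2 * r * S := by
      rw [← integral_const_mul, ← integral_const_mul, ← integral_sub (hA.const_mul _)
        (hS.const_mul _)]
      refine integral_congr_ae (.of_forall fun η => ?_)
      have := e2 η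
      simp only [D, s] at this ⊢
      rw [this]; ring
    have E1 : ∫ η, 2 * (r - s η) * (-l) * D r η ^ (-l - 1) ∂(normSurfaceMeasure n) =
        -2 * l * r * A + 2 * l * S := by
      rw [← integral_const_mul, ← integral_const_mul, ← integral_add (hA.const_mul _)
        (hS.const_mul _)]
      refine integral_congr_ae (.of_forall fun η => ?_)
      simp only; ring
    -- Uses (r - s)² = D - (1 - s²).
    have E2 : ∫ η, (2 * (-l) * D r η ^ (-l - 1) + 2 * (r - s η) * (-l) *
        (2 * (r - s η) * (-l - 1) * D r η ^ (-l - 1 - 1))) ∂(normSurfaceMeasure n) =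
        (-2 * l + 4 * l * (l + 1)) * A - 4 * l * (l + 1) * T := by
      rw [← integral_const_mul, ← integral_const_mul, ← integral_sub (hA.const_mul _)
        (hT.const_mul _)]
      refine integral_congr_ae (.of_forall fun η => ?_)
      simp only [e1]
      simp only [D]; ring
    dsimp only
    rw [E0, E1, E2]
    linear_combination (-2 * l * (1 - r ^ 2)) * hz'

theorem norm_sub_sphere_sq {n : ℕ} (x : EuclideanSpace ℝ (Fin n))
    (η : sphere (0 : EuclideanSpace ℝ (Fin n)) 1) :
    ‖x - η‖ ^ 2 = 1 + ‖x‖ ^ 2 - 2 * inner ℝ x (η : EuclideanSpace ℝ (Fin n)) := by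
  rw [norm_sub_sq_real, norm_eq_of_mem_sphere η]; ring

theorem norm_sub_sphere_pos {n : ℕ} {x : EuclideanSpace ℝ (Fin n)} (hx : ‖x‖ < 1)
    (η : sphere (0 : EuclideanSpace ℝ (Fin n)) 1) : 0 < ‖x - η‖ := by
  rw [norm_pos_iff, sub_ne_zero]
  rintro rfl
  rw [norm_eq_of_mem_sphere η] at hx
  exact lt_irrefl _ hx

/-- Spherical means of powers of the distance as hypergeometric functions. -/
theorem integral_norm_sub_rpow {n : ℕ} (hn : 2 ≤ n) (m : ℝ) {x : EuclideanSpace ℝ (Fin n)}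
    (hx : ‖x‖ < 1) :
    ∫ η, ‖x - (η : EuclideanSpace ℝ (Fin n))‖ ^ (-m) ∂(normSurfaceMeasure n) =
      (1 - ‖x‖ ^ 2) ^ ((n : ℝ) - 1 - m) *
        ₂F₁ ((n - m) / 2) (n - 1 - m / 2) ((n : ℝ) / 2) (‖x‖ ^ 2) := by
  have hn0 : 0 < n := by omega
  have := isProbabilityMeasure_normSurfaceMeasure hn0
  set b := EuclideanSpace.basisFun (Fin n) ℝ
  set i : Fin n := ⟨0, hn0⟩
  have hr : ‖x‖ ∈ Set.Ico (0 : ℝ) 1 := ⟨norm_nonneg x, hx⟩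
  have hsub : Set.Ico (0 : ℝ) 1 ⊆ Set.Ioo (-1 : ℝ) 1 := fun r hr => ⟨by linarith [hr.1], hr.2⟩
  have hrad : ∫ η, ‖x - (η : EuclideanSpace ℝ (Fin n))‖ ^ (-m) ∂(normSurfaceMeasure n) =
      ∫ η, (1 + ‖x‖ ^ 2 - 2 * ‖x‖ * inner ℝ (b i) (η : EuclideanSpace ℝ (Fin n))) ^ (-(m / 2))
        ∂(normSurfaceMeasure n) := by
    -- A reflection carries y, on a coordinate axis at the same radius, to x.
    set y := ‖x‖ • b i with hy
    have hyx : ‖y‖ = ‖x‖ := by rw [hy, norm_smul, b.norm_eq_one]; simp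
    set L := (ℝ ∙ (y - x))ᗮ.reflection
    have hL : L y = x := Submodule.reflection_sub hyx
    rw [← integral_normSurfaceMeasure_comp L fun z => ‖x - z‖ ^ (-m)]
    refine integral_congr_ae (.of_forall fun η => ?_)
    have h1 : ‖x - L η‖ = ‖y - η‖ := by rw [← hL, ← L.map_sub, L.norm_map]
    have h2 := norm_sub_sphere_sq y η
    rw [hyx, hy, inner_smul_left] at h2
    simp only [h1]
    rw [mul_assoc, show ‖x‖ * inner ℝ (b i) (η : EuclideanSpace ℝ (Fin n)) =
      (starRingEnd ℝ) ‖x‖ * inner ℝ (b i) (η : EuclideanSpace ℝ (Fin n)) from rfl, ← h2,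
      ← Real.rpow_natCast, ← Real.rpow_mul (norm_nonneg _)]
    congr 1
    push_cast; ring
  rw [hrad]
  obtain ⟨g', g'', hg⟩ := exists_deriv_integral_zonal_rpow b i (m / 2)
  obtain ⟨v', v'', hv⟩ := exists_deriv_rpow_mul_ordinaryHypergeometric n (m / 2)
    (by exact_mod_cast hn0)
  rw [show (n : ℝ) - 1 - 2 * (m / 2) = n - 1 - m by ring,
    show (n : ℝ) / 2 - m / 2 = (n - m) / 2 by ring] at hv
  have hcast : ((n - 1 : ℕ) : ℝ) = n - 1 := by rw [Nat.cast_pred hn0]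
  refine eq_of_singular_ode (N := n - 1) (by omega) (κ := 2 * (m / 2) + 2 - n)
    (M := 2 * (2 * (m / 2) + 2 - n) * (m / 2))
    (u := fun r => ∫ η, (1 + r ^ 2 - 2 * r *
      inner ℝ (b i) (η : EuclideanSpace ℝ (Fin n))) ^ (-(m / 2)) ∂(normSurfaceMeasure n))
    (v := fun r => (1 - r ^ 2) ^ ((n : ℝ) - 1 - m) *
      ₂F₁ ((n - m) / 2) (n - 1 - m / 2) ((n : ℝ) / 2) (r ^ 2))
    (fun r hr => (hg r (hsub hr)).1) (fun r hr => (hg r (hsub hr)).2.1)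
    (fun r hr => (hv r hr).1) (fun r hr => (hv r hr).2.1)
    (fun r hr => by rw [hcast]; exact (hg r (hsub hr)).2.2)
    (fun r hr => by rw [hcast]; exact (hv r hr).2.2) (fun r hr => ?_) ?_ hr
  · have hpos : ∀ η : sphere (0 : EuclideanSpace ℝ (Fin n)) 1,
        0 < 1 + r ^ 2 - 2 * r * inner ℝ (b i) (η : EuclideanSpace ℝ (Fin n)) := fun η =>
      one_add_sq_sub_pos (hsub hr) (inner_sphere_mem_Icc (b.norm_eq_one i) η)
    exact integral_pos_of_continuous_pos
      (Continuous.rpow_const (by fun_prop) fun η => Or.inl (hpos η).ne')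
      fun η => Real.rpow_pos_of_pos (hpos η) _
  · simp

/-! ### The Poisson kernel and its L^q norm -/

theorem poissonConst_pos {n : ℕ} (hn : 0 < n) {β : ℝ} (hβ : (n : ℝ) ≤ β) :
    0 < poissonConst n β := by
  have h : (0 : ℝ) < n := by exact_mod_cast hn
  unfold poissonConst
  have h1 := Real.Gamma_pos_of_pos (s := β / 2) (by linarith)
  have h2 := Real.Gamma_pos_of_pos (s := β / 2 - n / 2 + 1) (by linarith)
  have h3 := Real.Gamma_pos_of_pos (s := (n : ℝ) / 2) (by linarith)
  have h4 := Real.Gamma_pos_of_pos (s := β - n + 1) (by linarith)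
  positivity

theorem poissonKer_pos {n : ℕ} (α β : ℝ) {x : EuclideanSpace ℝ (Fin n)} (hx : ‖x‖ < 1)
    (η : sphere (0 : EuclideanSpace ℝ (Fin n)) 1) : 0 < poissonKer α β x η :=
  div_pos (Real.rpow_pos_of_pos (by nlinarith [norm_nonneg x]) _)
    (Real.rpow_pos_of_pos (norm_sub_sphere_pos hx η) _)

theorem continuous_poissonKer {n : ℕ} (α β : ℝ) {x : EuclideanSpace ℝ (Fin n)} (hx : ‖x‖ < 1) :
    Continuous (poissonKer α β x) := by
  unfold poissonKer
  refine Continuous.div continuous_const (Continuous.rpow_const (by fun_prop) fun η =>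
    Or.inl (norm_sub_sphere_pos hx η).ne') fun η =>
      (Real.rpow_pos_of_pos (norm_sub_sphere_pos hx η) _).ne'

/-- The relation n + α = β + 1 makes β cancel from the exponent αq + n - 1 - qβ. -/
theorem integral_poissonKer_rpow {n : ℕ} (hn : 2 ≤ n) {α β : ℝ} (hαβ : (n : ℝ) + α = β + 1)
    (q : ℝ) {x : EuclideanSpace ℝ (Fin n)} (hx : ‖x‖ < 1) :
    ∫ η, poissonKer α β x η ^ q ∂(normSurfaceMeasure n) =
      (1 - ‖x‖ ^ 2) ^ (((n : ℝ) - 1) * (1 - q)) *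
        ₂F₁ ((n - q * β) / 2) (n - 1 - q * β / 2) ((n : ℝ) / 2) (‖x‖ ^ 2) := by
  have hw : 0 < 1 - ‖x‖ ^ 2 := by nlinarith [norm_nonneg x]
  have h : ∀ η : sphere (0 : EuclideanSpace ℝ (Fin n)) 1, poissonKer α β x η ^ q =
      (1 - ‖x‖ ^ 2) ^ (α * q) * ‖x - (η : EuclideanSpace ℝ (Fin n))‖ ^ (-(q * β)) := fun η => by
    rw [poissonKer, Real.div_rpow (Real.rpow_nonneg hw.le _) (Real.rpow_nonneg (norm_nonneg _) _),
      ← Real.rpow_mul hw.le, ← Real.rpow_mul (norm_nonneg _), Real.rpow_neg (norm_nonneg _),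
      div_eq_mul_inv, mul_comm β q]
  simp only [h]
  rw [integral_const_mul, integral_norm_sub_rpow hn _ hx, ← mul_assoc, ← Real.rpow_add hw]
  congr 2
  obtain rfl : α = β + 1 - n := by linarith
  ring

theorem sharpFun_div_eq {n : ℕ} (hn : 2 ≤ n) {α β : ℝ} (hαβ : (n : ℝ) + α = β + 1)
    {q s : ℝ} (hq : 0 < q) (hs : s + 1 / q = 1) {x : EuclideanSpace ℝ (Fin n)} (hx : ‖x‖ < 1) :
    sharpFun β q x / (1 - ‖x‖ ^ 2) ^ (((n : ℝ) - 1) * s) = poissonConst n β *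
      (∫ η, poissonKer α β x η ^ q ∂(normSurfaceMeasure n)) ^ (1 / q) := by
  have := isProbabilityMeasure_normSurfaceMeasure (n := n) (by omega)
  have hw : 0 < 1 - ‖x‖ ^ 2 := by nlinarith [norm_nonneg x]
  have hI : 0 < ∫ η, poissonKer α β x η ^ q ∂(normSurfaceMeasure n) :=
    integral_pos_of_continuous_pos ((continuous_poissonKer α β hx).rpow_const
      fun η => Or.inl (poissonKer_pos α β hx η).ne')
      fun η => Real.rpow_pos_of_pos (poissonKer_pos α β hx η) _
  have hwp := Real.rpow_pos_of_pos hw (((n : ℝ) - 1) * (1 - q))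
  rw [integral_poissonKer_rpow hn hαβ q hx] at hI ⊢
  -- Positivity of F comes from the integral, so the signs of the series coefficients play no role.
  have hF := (pos_iff_pos_of_mul_pos hI).1 hwp
  rw [Real.mul_rpow hwp.le hF.le, ← Real.rpow_mul hw.le, sharpFun, div_eq_mul_inv,
    ← Real.rpow_neg hw.le]
  have : ((n : ℝ) - 1) * (1 - q) * (1 / q) = -(((n : ℝ) - 1) * s) := by
    obtain rfl : s = 1 - 1 / q := by linarith
    field_simp
    ring
  rw [this]
  ring

/-! ### Hölder's inequality, extremal functions and sharpness -/

theorem Continuous.memLp_of_compactSpace {S E : Type*} [TopologicalSpace S] [CompactSpace S]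
    [MeasurableSpace S] [OpensMeasurableSpace S] [NormedAddCommGroup E]
    [SecondCountableTopologyEither S E] {μ : Measure S} [IsFiniteMeasure μ] {f : S → E}
    (hf : Continuous f) (p : ENNReal) : MemLp f p μ := by
  obtain ⟨C, hC⟩ := isCompact_univ.exists_bound_of_continuousOn hf.continuousOn
  exact MemLp.of_bound hf.aestronglyMeasurable C (.of_forall fun s => hC s trivial)

theorem toReal_eLpNorm_of_pos {S : Type*} [MeasurableSpace S] {μ : Measure S} {f : S → ℝ}
    {q : ENNReal} (hq0 : q ≠ 0) (hq : q ≠ ⊤) (hf : MemLp f q μ) (hpos : ∀ s, 0 < f s) :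
    (eLpNorm f q μ).toReal = (∫ s, f s ^ q.toReal ∂μ) ^ (1 / q.toReal) := by
  rw [hf.eLpNorm_eq_integral_rpow_norm hq0 hq, ENNReal.toReal_ofReal (by positivity), one_div]
  simp only [Real.norm_of_nonneg (hpos _).le]

theorem norm_integral_smul_le_of_holderConjugate {S E : Type*} [MeasurableSpace S]
    [NormedAddCommGroup E] [NormedSpace ℝ E] {μ : Measure S} {p q : ENNReal}
    (hpq : ENNReal.HolderConjugate p q) {f : S → ℝ} {φ : S → E} (hf : MemLp f q μ)
    (hφ : MemLp φ p μ) : Integrable (fun s => f s • φ s) μ ∧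
      ‖∫ s, f s • φ s ∂μ‖ ≤ (eLpNorm f q μ).toReal * (eLpNorm φ p μ).toReal := by
  have := hpq.symm
  have hint : Integrable (f • φ) μ := memLp_one_iff_integrable.1 (hφ.smul hf)
  refine ⟨hint, (norm_integral_le_integral_norm _).trans ?_⟩
  rw [← ENNReal.toReal_mul]
  have h1 : ∫ s, ‖f s • φ s‖ ∂μ = (eLpNorm (f • φ) 1 μ).toReal := by
    rw [eLpNorm_one_eq_lintegral_enorm]
    exact integral_norm_eq_lintegral_enorm hint.aestronglyMeasurable
  rw [h1]
  exact ENNReal.toReal_mono (ENNReal.mul_ne_top hf.eLpNorm_ne_top hφ.eLpNorm_ne_top)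
    (eLpNorm_smul_le_mul_eLpNorm hφ.aestronglyMeasurable hf.aestronglyMeasurable)

theorem toReal_inv_add_one_div_toReal {p q : ENNReal} (hpq : ENNReal.HolderConjugate p q)
    (hp : 1 < p) : q ≠ 0 ∧ q ≠ ⊤ ∧ (p⁻¹).toReal + 1 / q.toReal = 1 := by
  have h := hpq.inv_add_inv_eq_one
  have hp0 : p⁻¹ ≠ ⊤ := ENNReal.inv_ne_top.2 (zero_lt_one.trans hp).ne'
  have hq0 : q ≠ 0 := by
    rintro rfl
    simp at h
  refine ⟨hq0, ?_, ?_⟩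
  · rintro rfl
    rw [ENNReal.inv_top, add_zero] at h
    exact hp.ne' (by simpa using h)
  · rw [one_div, ← ENNReal.toReal_inv, ← ENNReal.toReal_add hp0 (ENNReal.inv_ne_top.2 hq0), h]
    simp

theorem toReal_eLpNorm_rpow_smul {S E : Type*} [MeasurableSpace S] [NormedAddCommGroup E]
    [NormedSpace ℝ E] {μ : Measure S} [IsProbabilityMeasure μ] {p q : ENNReal} (hp : p ≠ 0)
    {f : S → ℝ} (hpos : ∀ s, 0 < f s) {e : E} (he : ‖e‖ = 1)
    (hf : MemLp (fun s => f s ^ (q / p).toReal • e) p μ) :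
    (eLpNorm (fun s => f s ^ (q / p).toReal • e) p μ).toReal =
      (∫ s, f s ^ q.toReal ∂μ) ^ (p⁻¹).toReal := by
  -- For p = ∞ the exponent q/p is 0: the function is the constant e, and both sides equal 1.
  rcases eq_or_ne p ⊤ with rfl | hp'
  · have he' : ‖e‖ₑ = 1 := by rw [← ofReal_norm, he, ENNReal.ofReal_one]
    simp [eLpNormEssSup_const e (IsProbabilityMeasure.ne_zero μ), he']
  · have hpr := (ENNReal.toReal_pos hp hp').ne'
    rw [hf.eLpNorm_eq_integral_rpow_norm hp hp', ENNReal.toReal_ofReal (by positivity),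
      ENNReal.toReal_inv]
    congr 1
    refine integral_congr_ae (.of_forall fun s => ?_)
    simp only [norm_smul, he, mul_one, Real.norm_of_nonneg (Real.rpow_nonneg (hpos s).le _),
      ← Real.rpow_mul (hpos s).le, ENNReal.toReal_div, div_mul_cancel₀ _ hpr]

theorem norm_poissonInt_rpow_smul {n : ℕ} (hn : 0 < n) {α β : ℝ} (hβ : (n : ℝ) ≤ β) {q t : ℝ}
    (hqt : 1 + t = q) {x : EuclideanSpace ℝ (Fin n)} (hx : ‖x‖ < 1)
    {e : EuclideanSpace ℝ (Fin n)} (he : ‖e‖ = 1) :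
    ‖poissonInt α β (fun η => poissonKer α β x η ^ t • e) x‖ =
      poissonConst n β * ∫ η, poissonKer α β x η ^ q ∂(normSurfaceMeasure n) := by
  have h : ∀ η : sphere (0 : EuclideanSpace ℝ (Fin n)) 1,
      poissonKer α β x η • poissonKer α β x η ^ t • e = poissonKer α β x η ^ q • e := fun η => by
    rw [smul_smul, ← hqt, Real.rpow_add (poissonKer_pos α β hx η), Real.rpow_one]
  have hI : 0 ≤ ∫ η, poissonKer α β x η ^ q ∂(normSurfaceMeasure n) :=
    integral_nonneg fun η => Real.rpow_nonneg (poissonKer_pos α β hx η).le _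
  rw [poissonInt]
  simp only [h]
  rw [integral_smul_const, norm_smul, norm_smul, he, mul_one,
    Real.norm_of_nonneg (poissonConst_pos hn hβ).le, Real.norm_of_nonneg hI]

theorem theorem1p3 (n : ℕ) (hn : 3 ≤ n) (α β : ℝ) (hαβ : (n : ℝ) + α = β + 1)
    (hβ : (n : ℝ) ≤ β) (p q : ENNReal) (hp : 1 < p) (hpq : ENNReal.HolderConjugate p q)
    (x : EuclideanSpace ℝ (Fin n)) (hx : x ∈ ball (0 : EuclideanSpace ℝ (Fin n)) 1) :
    -- the integral defining `u` converges absolutely, and the pointwise bound holds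
    (∀ φ : sphere (0 : EuclideanSpace ℝ (Fin n)) 1 → EuclideanSpace ℝ (Fin n),
      MemLp φ p (normSurfaceMeasure n) →
        Integrable (fun η => poissonKer α β x η • φ η) (normSurfaceMeasure n) ∧
        ‖poissonInt α β φ x‖ ≤
          sharpFun β q.toReal x / (1 - ‖x‖ ^ 2) ^ (((n : ℝ) - 1) * (p⁻¹).toReal) *
            (eLpNorm φ p (normSurfaceMeasure n)).toReal) ∧
    -- equality holds for the nonzero `L^p` function `P(x,·)^{q/p} e`, `e` any unit vector
    (∀ e : EuclideanSpace ℝ (Fin n), ‖e‖ = 1 →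
      ∀ φ₀ : sphere (0 : EuclideanSpace ℝ (Fin n)) 1 → EuclideanSpace ℝ (Fin n),
        (φ₀ = fun η => (poissonKer α β x η) ^ (q / p).toReal • e) →
        MemLp φ₀ p (normSurfaceMeasure n) ∧
        0 < (eLpNorm φ₀ p (normSurfaceMeasure n)).toReal ∧
        ‖poissonInt α β φ₀ x‖ =
          sharpFun β q.toReal x / (1 - ‖x‖ ^ 2) ^ (((n : ℝ) - 1) * (p⁻¹).toReal) *
            (eLpNorm φ₀ p (normSurfaceMeasure n)).toReal) ∧
    -- `C_p(x)` is the best constant at `x`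
    IsLeast {C : ℝ |
      ∀ φ : sphere (0 : EuclideanSpace ℝ (Fin n)) 1 → EuclideanSpace ℝ (Fin n),
        MemLp φ p (normSurfaceMeasure n) →
        ‖poissonInt α β φ x‖ ≤
          C / (1 - ‖x‖ ^ 2) ^ (((n : ℝ) - 1) * (p⁻¹).toReal) *
            (eLpNorm φ p (normSurfaceMeasure n)).toReal}
      (sharpFun β q.toReal x) := by
  have hx' : ‖x‖ < 1 := by simpa using hx
  have hn0 : 0 < n := by omega
  have hn2 : 2 ≤ n := by omega
  have := isProbabilityMeasure_normSurfaceMeasure hn0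
  obtain ⟨hq0, hqtop, hs⟩ := toReal_inv_add_one_div_toReal hpq hp
  have hqr : 0 < q.toReal := ENNReal.toReal_pos hq0 hqtop
  have hP := continuous_poissonKer α β hx'
  have hPpos := poissonKer_pos α β hx'
  have hPq : MemLp (poissonKer α β x) q (normSurfaceMeasure n) := hP.memLp_of_compactSpace q
  have hc := poissonConst_pos hn0 hβ
  have hI : 0 < ∫ η, poissonKer α β x η ^ q.toReal ∂(normSurfaceMeasure n) :=
    integral_pos_of_continuous_pos (hP.rpow_const fun η => Or.inl (hPpos η).ne')
      fun η => Real.rpow_pos_of_pos (hPpos η) _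
  have hK := sharpFun_div_eq hn2 hαβ hqr hs hx'
  have h1 : ∀ φ : sphere (0 : EuclideanSpace ℝ (Fin n)) 1 → EuclideanSpace ℝ (Fin n),
      MemLp φ p (normSurfaceMeasure n) →
        Integrable (fun η => poissonKer α β x η • φ η) (normSurfaceMeasure n) ∧
        ‖poissonInt α β φ x‖ ≤
          sharpFun β q.toReal x / (1 - ‖x‖ ^ 2) ^ (((n : ℝ) - 1) * (p⁻¹).toReal) *
            (eLpNorm φ p (normSurfaceMeasure n)).toReal := by
    intro φ hφ
    obtain ⟨hint, hle⟩ := norm_integral_smul_le_of_holderConjugate hpq hPq hφ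
    refine ⟨hint, ?_⟩
    rw [toReal_eLpNorm_of_pos hq0 hqtop hPq hPpos] at hle
    rw [hK, poissonInt, norm_smul, Real.norm_of_nonneg hc.le, mul_assoc]
    exact mul_le_mul_of_nonneg_left hle hc.le
  have h2 : ∀ e : EuclideanSpace ℝ (Fin n), ‖e‖ = 1 →
      ∀ φ₀ : sphere (0 : EuclideanSpace ℝ (Fin n)) 1 → EuclideanSpace ℝ (Fin n),
        (φ₀ = fun η => (poissonKer α β x η) ^ (q / p).toReal • e) →
        MemLp φ₀ p (normSurfaceMeasure n) ∧
        0 < (eLpNorm φ₀ p (normSurfaceMeasure n)).toReal ∧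
        ‖poissonInt α β φ₀ x‖ =
          sharpFun β q.toReal x / (1 - ‖x‖ ^ 2) ^ (((n : ℝ) - 1) * (p⁻¹).toReal) *
            (eLpNorm φ₀ p (normSurfaceMeasure n)).toReal := by
    rintro e he φ₀ rfl
    have hmem : MemLp (fun η => (poissonKer α β x η) ^ (q / p).toReal • e) p
        (normSurfaceMeasure n) :=
      Continuous.memLp_of_compactSpace
        ((hP.rpow_const fun η => Or.inl (hPpos η).ne').smul continuous_const) p
    have hqt : 1 + (q / p).toReal = q.toReal := by
      rw [div_eq_mul_inv, ENNReal.toReal_mul, eq_sub_of_add_eq hs]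
      field_simp
      ring
    have hnorm := toReal_eLpNorm_rpow_smul (zero_lt_one.trans hp).ne' hPpos he hmem
    refine ⟨hmem, ?_, ?_⟩
    · rw [hnorm]
      exact Real.rpow_pos_of_pos hI _
    · rw [hnorm, hK, norm_poissonInt_rpow_smul hn0 hβ hqt hx' he, mul_assoc, ← Real.rpow_add hI,
        add_comm, hs, Real.rpow_one]
  refine ⟨h1, h2, fun φ hφ => (h1 φ hφ).2, fun C hC => ?_⟩
  -- An admissible C is tested on one extremal function; its positive norm cancels.
  obtain ⟨hmem, hpos, heq⟩ := h2 _ ((EuclideanSpace.basisFun (Fin n) ℝ).norm_eq_one ⟨0, hn0⟩) _ rfl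
  have hle := hC _ hmem
  rw [heq] at hle
  have hw : 0 < (1 - ‖x‖ ^ 2) ^ (((n : ℝ) - 1) * (p⁻¹).toReal) :=
    Real.rpow_pos_of_pos (by nlinarith [norm_nonneg x]) _
  exact (div_le_div_iff_of_pos_right hw).1 (le_of_mul_le_mul_right hle hpos)
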